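/- Let $\{X_n\}_{n\ge 0}$ be a Markov chain with finite state space $S$ and irreducible transition matrix $P=[p_{ij}]$. For $i,j\in S$ let $T_{ij}=\min\{n\ge 1: X_n=j\}$ given $X_0=i$ (the first passage time from $i$ to $j$, or the first return time if $i=j$), and let $m_{ij}=E[T_{ij}]$ and $m_{ij}^{(2)}=E[T_{ij}^2]$. Let $b\in S$, let $\mathbf e$ be the column vector of ones and $\mathbf e_b$ the $b$-th standard basis vector. Then $I-P+\mathbf e\,\mathbf e_b^{T}$ is invertible; put $$G=[g_{ij}]=[I-P+\mathbf e\,\mathbf e_b^{T}]^{-1},\qquad G^2=[g_{ij}^{(2)}].$$ All the $T_{ij}$ are almost surely finite with finite second moments, and $$m_{ij}^{(2)}=\begin{cases} m_{jj}\bigl[1+2m_{jj}(g_{jj}-g_{bj}^{(2)})\bigr], & i=j,\\[2pt] 2m_{jj}\bigl[g_{jj}^{(2)}-g_{ij}^{(2)}+m_{ij}(g_{jj}-g_{bj}^{(2)})\bigr]-m_{ij}, & i\neq j.\end{cases}$$ Further, $$\operatorname{var}[T_{ij}]=\begin{cases} m_{jj}\bigl[1-m_{jj}+2m_{jj}(g_{jj}-g_{bj}^{(2)})\bigr],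 & i=j,\\[2pt] 2m_{jj}\bigl[g_{jj}^{(2)}-g_{ij}^{(2)}+m_{ij}(g_{jj}-g_{bj}^{(2)})\bigr]-m_{ij}(1+m_{ij}), & i\neq j.\end{cases}$$ -/

import Mathlib

open MeasureTheory ProbabilityTheory

noncomputable section

/-- `X` is, under `μ`, a (time-homogeneous) Markov chain with state space `S` and transition
matrix `P`: whatever the past `X 0 = x 0, …, X n = x n`, the next state is `x (n + 1)` with
probability `P (x n) (x (n + 1))`. The conditional probability is multiplied out, so that nothing is
said about pasts of probability zero. The initial distribution is arbitrary. -/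
structure IsMarkovChain {Ω S : Type*} [MeasurableSpace Ω] [MeasurableSpace S]
    (μ : Measure Ω) (X : ℕ → Ω → S) (P : Matrix S S ℝ) : Prop where
  measurable : ∀ n, Measurable (X n)
  markov : ∀ (n : ℕ) (x : ℕ → S),
    μ {ω | ∀ k ≤ n + 1, X k ω = x k} =
      μ {ω | ∀ k ≤ n, X k ω = x k} * ENNReal.ofReal (P (x n) (x (n + 1)))

/-- The first passage time `min {n ≥ 1 : X n = j}` to the state `j`, as an extended natural number;
it is `⊤` on the event that `j` is never visited at a time `n ≥ 1`. -/
def firstPassageTime {Ω S : Type*} (X : ℕ → Ω → S) (j : S) (ω : Ω) : ℕ∞ :=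
  ⨅ (n : ℕ) (_ : 1 ≤ n ∧ X n ω = j), (n : ℕ∞)

/-- The first passage time to `j` as a real random variable; the value on the event that
`firstPassageTime X j` is infinite is irrelevant when that event is null. -/
def passageTimeReal {Ω S : Type*} (X : ℕ → Ω → S) (j : S) (ω : Ω) : ℝ :=
  ((firstPassageTime X j ω).toNat : ℝ)

/-- The moment `m_ij^(k) = E[T_ij ^ k]`, where `μ i` is the law under which the chain starts in
`i`. -/
def passageMoment {Ω S : Type*} [MeasurableSpace Ω] (μ : S → Measure Ω) (X : ℕ → Ω → S)
    (k : ℕ) (i j : S) : ℝ :=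
  ∫ ω, passageTimeReal X j ω ^ k ∂(μ i)

/-- The matrix `I - P + e e_bᵀ`, where `e` is the all-ones column vector and `e_b` the `b`-th
standard basis vector. -/
def kernelMatrix {S : Type*} [DecidableEq S] (P : Matrix S S ℝ) (b : S) : Matrix S S ℝ :=
  1 - P + Matrix.vecMulVec (fun _ => 1) (Pi.single b 1)

end

/-! Fix the target `j` and let `Q` be `tabooMatrix P j`. By the Markov property, the chain from `i`
avoids `j` during steps 1 to n with probability `(Q ^ n *ᵥ 1) i`
(`IsMarkovChain.measureReal_lt_firstPassageTime`). Summing tails gives `E[T] = w = ∑ Qⁿ 1` and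
`E[T²] = 2s - w` with `s = ∑ (n+1) Qⁿ 1`, so `(1 - Q) w = 1` and `(1 - Q) s = w`. Convergence
follows from invertibility of `1 - Q`, a maximum principle resting on irreducibility, by
telescoping.

Since `Q v = P (v - v_j e_j)`, applying `kernelMatrix` to `v - v_j e_j` turns each equation into one
solved by `G`, with only `v_j` and a multiple of `1 = G 1` unknown. Row `j` fixes the multiple and
row `b` fixes `v_j`; doing this for `w` and then `s` yields the formulas
(`passage_equations_solution`). -/

/-- The matrix `P` with its `j`-th column replaced by zero: the transition matrix of the chain
that is killed when it enters `j`. -/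
def tabooMatrix {S : Type*} [DecidableEq S] (P : Matrix S S ℝ) (j : S) : Matrix S S ℝ :=
  P.updateCol j 0

/-! ### Killed chain: maximum principle, invertibility, convergent series -/

section Matrix

open Matrix

variable {S : Type*}

lemma tabooMatrix_apply [DecidableEq S] (P : Matrix S S ℝ) (j i k : S) :
    tabooMatrix P j i k = if k = j then 0 else P i k := by
  simp [tabooMatrix, Matrix.updateCol_apply]

lemma mulVec_nonneg [Fintype S] {A : Matrix S S ℝ} (hA : ∀ i k, 0 ≤ A i k) {v : S → ℝ} (hv : 0 ≤ v) :
    0 ≤ A *ᵥ v :=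
  fun i => Finset.sum_nonneg fun k _ => mul_nonneg (hA i k) (hv k)

variable [Fintype S] [DecidableEq S] {P : Matrix S S ℝ}

lemma tabooMatrix_nonneg (hP : P ∈ rowStochastic ℝ S) (j i k : S) : 0 ≤ tabooMatrix P j i k := by
  rw [tabooMatrix_apply]
  split_ifs
  exacts [le_rfl, nonneg_of_mem_rowStochastic hP]

lemma tabooMatrix_mulVec (P : Matrix S S ℝ) (j : S) (v : S → ℝ) (i : S) :
    (tabooMatrix P j *ᵥ v) i = (P *ᵥ v) i - P i j * v j := by
  simp only [mulVec, dotProduct, tabooMatrix_apply]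
  rw [← Finset.add_sum_erase _ _ (Finset.mem_univ j),
    ← Finset.add_sum_erase _ (fun k => P i k * v k) (Finset.mem_univ j)]
  simp only [if_true, zero_mul, zero_add, add_sub_cancel_left]
  refine Finset.sum_congr rfl fun k hk => ?_
  rw [if_neg (Finset.ne_of_mem_erase hk)]

/-- The maximum principle for the killed chain. -/
lemma eq_zero_of_tabooMatrix_mulVec_eq (hP : P ∈ rowStochastic ℝ S) (hirr : P.IsIrreducible)
    (j : S) {v : S → ℝ} (hv : tabooMatrix P j *ᵥ v = v) : v = 0 := by
  obtain ⟨i₀, -, hi₀⟩ := Finset.exists_max_image Finset.univ (fun i => |v i|) ⟨j, Finset.mem_univ j⟩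
  set M := |v i₀| with hM
  have hle : ∀ i, |v i| ≤ M := fun i => hi₀ i (Finset.mem_univ i)
  rcases (abs_nonneg (v i₀)).eq_or_lt with h0 | hpos
  · funext i
    exact abs_eq_zero.1 (le_antisymm ((hle i).trans h0.ge) (abs_nonneg _))
  have hnn : ∀ i k, 0 ≤ P i k := fun i k => nonneg_of_mem_rowStochastic hP
  -- At a state of maximal modulus, `M ≤ ∑ Q |v| ≤ ∑ P M = M` is an equality term by term. Hence
  -- such a state has no transition to `j`, and its possible successors are again maximal, so `j` is
  -- unreachable from `i₀`.
  have step : ∀ i, |v i| = M → ∀ k, P i k * M - tabooMatrix P j i k * |v k| = 0 := by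
    intro i hi
    have hterm : ∀ k ∈ Finset.univ, 0 ≤ P i k * M - tabooMatrix P j i k * |v k| := by
      intro k _
      rw [tabooMatrix_apply, sub_nonneg]
      split_ifs
      · rw [zero_mul]; exact mul_nonneg (hnn i k) hpos.le
      · exact mul_le_mul_of_nonneg_left (hle k) (hnn i k)
    have hsum : ∑ k, (P i k * M - tabooMatrix P j i k * |v k|) ≤ 0 := by
      rw [Finset.sum_sub_distrib, ← Finset.sum_mul, sum_row_of_mem_rowStochastic hP, one_mul,
        sub_nonpos, ← hi]
      calc |v i| = |∑ k, tabooMatrix P j i k * v k| := by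
            conv_lhs => rw [← hv]
            rfl
        _ ≤ ∑ k, |tabooMatrix P j i k * v k| := Finset.abs_sum_le_sum_abs _ _
        _ = ∑ k, tabooMatrix P j i k * |v k| := by
            simp only [abs_mul, abs_of_nonneg (tabooMatrix_nonneg hP j i _)]
    intro k
    exact (Finset.sum_eq_zero_iff_of_nonneg hterm).1
      (le_antisymm hsum (Finset.sum_nonneg hterm)) k (Finset.mem_univ k)
  have hj : ∀ i, |v i| = M → P i j = 0 := by
    intro i hi
    have := step i hi j
    rw [tabooMatrix_apply, if_pos rfl, zero_mul, sub_zero] at this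
    exact (mul_eq_zero.1 this).resolve_right hpos.ne'
  have hpow : ∀ n i, |v i| = M → (P ^ (n + 1)) i j = 0 := by
    intro n
    induction n with
    | zero => simpa using hj
    | succ n ih =>
      intro i hi
      rw [pow_succ', mul_apply]
      refine Finset.sum_eq_zero fun k _ => ?_
      by_cases hkj : k = j
      · rw [hkj, hj i hi, zero_mul]
      · have := step i hi k
        rw [tabooMatrix_apply, if_neg hkj, ← mul_sub] at this
        rcases mul_eq_zero.1 this with h | h
        · rw [h, zero_mul]
        · rw [ih k (sub_eq_zero.1 h).symm, mul_zero]
  obtain ⟨n, hn, hlt⟩ := (isIrreducible_iff_exists_pow_pos hnn).1 hirr i₀ j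
  obtain ⟨n, rfl⟩ := Nat.exists_eq_succ_of_ne_zero hn.ne'
  exact absurd (hpow n i₀ rfl) hlt.ne'

lemma isUnit_of_mulVec_eq_zero {A : Matrix S S ℝ} (h : ∀ v, A *ᵥ v = 0 → v = 0) : IsUnit A :=
  mulVec_injective_iff_isUnit.1 ((injective_iff_map_eq_zero A.mulVecLin).2 h)

lemma isUnit_one_sub_tabooMatrix (hP : P ∈ rowStochastic ℝ S) (hirr : P.IsIrreducible) (j : S) :
    IsUnit (1 - tabooMatrix P j) := by
  refine isUnit_of_mulVec_eq_zero fun v hv => eq_zero_of_tabooMatrix_mulVec_eq hP hirr j ?_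
  rw [sub_mulVec, one_mulVec, sub_eq_zero] at hv
  exact hv.symm

lemma kernelMatrix_mulVec (P : Matrix S S ℝ) (b : S) (v : S → ℝ) (i : S) :
    (kernelMatrix P b *ᵥ v) i = v i - (P *ᵥ v) i + v b := by
  simp [kernelMatrix, add_mulVec, sub_mulVec, vecMulVec_mulVec]

/-- A null vector satisfies `P v = v + v b`. Averaging cannot raise the maximum of `v` nor lower its
minimum, so `v b = 0`; then `v` is also fixed by the matrix killed at `b`, and the maximum principle
applies. -/
lemma isUnit_kernelMatrix (hP : P ∈ rowStochastic ℝ S) (hirr : P.IsIrreducible) (b : S) :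
    IsUnit (kernelMatrix P b) := by
  refine isUnit_of_mulVec_eq_zero fun v hv => ?_
  have hv' : ∀ i, (P *ᵥ v) i = v i + v b := fun i => by
    have := congrFun hv i
    rw [kernelMatrix_mulVec, Pi.zero_apply] at this
    linarith
  have avg : ∀ i c, (P *ᵥ v) i - c = ∑ k, P i k * (v k - c) := fun i c => by
    simp only [mul_sub, Finset.sum_sub_distrib, ← Finset.sum_mul,
      sum_row_of_mem_rowStochastic hP, one_mul]
    rfl
  have hnn : ∀ i k, 0 ≤ P i k := fun i k => nonneg_of_mem_rowStochastic hP
  obtain ⟨i, -, hi⟩ := Finset.exists_max_image Finset.univ v ⟨b, Finset.mem_univ b⟩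
  obtain ⟨l, -, hl⟩ := Finset.exists_min_image Finset.univ v ⟨b, Finset.mem_univ b⟩
  have h1 : v b ≤ 0 := by
    have : (P *ᵥ v) i - v i ≤ 0 := by
      rw [avg]
      exact Finset.sum_nonpos fun k _ => mul_nonpos_of_nonneg_of_nonpos (hnn i k)
        (sub_nonpos.2 (hi k (Finset.mem_univ k)))
    linarith [hv' i]
  have h2 : 0 ≤ v b := by
    have : 0 ≤ (P *ᵥ v) l - v l := by
      rw [avg]
      exact Finset.sum_nonneg fun k _ => mul_nonneg (hnn l k)
        (sub_nonneg.2 (hl k (Finset.mem_univ k)))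
    linarith [hv' l]
  have hb : v b = 0 := le_antisymm h1 h2
  refine eq_zero_of_tabooMatrix_mulVec_eq hP hirr b (funext fun k => ?_)
  rw [tabooMatrix_mulVec, hv', hb]
  ring

lemma pow_mulVec_nonneg {A : Matrix S S ℝ} (hA : ∀ i k, 0 ≤ A i k) {v : S → ℝ} (hv : 0 ≤ v)
    (n : ℕ) : 0 ≤ A ^ n *ᵥ v := by
  induction n with
  | zero => simpa using hv
  | succ n ih =>
    rw [pow_succ', ← mulVec_mulVec]
    exact mulVec_nonneg hA ih

lemma pow_mulVec_apply_le {A : Matrix S S ℝ} (hA : ∀ i k, 0 ≤ A i k) (hA1 : ∀ i, ∑ k, A i k ≤ 1)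
    {v : S → ℝ} {c : ℝ} (hc : 0 ≤ c) (hv : ∀ i, |v i| ≤ c) (n : ℕ) (i : S) :
    |(A ^ n *ᵥ v) i| ≤ c := by
  induction n generalizing i with
  | zero => simpa using hv i
  | succ n ih =>
    rw [pow_succ', ← mulVec_mulVec]
    calc |∑ k, A i k * (A ^ n *ᵥ v) k| ≤ ∑ k, |A i k * (A ^ n *ᵥ v) k| :=
          Finset.abs_sum_le_sum_abs _ _
      _ ≤ ∑ k, A i k * c := Finset.sum_le_sum fun k _ => by
          rw [abs_mul, abs_of_nonneg (hA i k)]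
          exact mul_le_mul_of_nonneg_left (ih k) (hA i k)
      _ ≤ c := by
          rw [← Finset.sum_mul]
          exact mul_le_of_le_one_left hc (hA1 i)

lemma pow_mulVec_eq_sub {A : Matrix S S ℝ} {v w : S → ℝ} (h : (1 - A) *ᵥ w = v) (n : ℕ) (i : S) :
    (A ^ n *ᵥ v) i = (A ^ n *ᵥ w) i - (A ^ (n + 1) *ᵥ w) i := by
  rw [← h, mulVec_mulVec, mul_sub, mul_one, ← pow_succ, sub_mulVec, Pi.sub_apply]

/-- For a substochastic matrix `A` with `1 - A` invertible, the series `∑ Aⁿ v` converges, to a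
solution of `w = v + A w`. -/
lemma exists_hasSum_pow_mulVec {A : Matrix S S ℝ} (hA : ∀ i k, 0 ≤ A i k)
    (hA1 : ∀ i, ∑ k, A i k ≤ 1) (hu : IsUnit (1 - A)) {v : S → ℝ} (hv : 0 ≤ v) :
    ∃ w : S → ℝ, 0 ≤ w ∧ (∀ i, HasSum (fun n => (A ^ n *ᵥ v) i) (w i)) ∧
      (1 - A) *ᵥ w = v := by
  -- No sign of `u` is needed: its boundedness alone bounds the telescoped partial sums by `2c`.
  obtain ⟨u, huv⟩ := mulVec_surjective_iff_isUnit.2 hu v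
  obtain ⟨c, hc⟩ : ∃ c, ∀ i, |u i| ≤ c :=
    ⟨∑ i, |u i|, fun i =>
      Finset.single_le_sum (f := fun i => |u i|) (fun k _ => abs_nonneg _) (Finset.mem_univ i)⟩
  have hsum : ∀ i, Summable fun n => (A ^ n *ᵥ v) i := by
    intro i
    have hc0 : 0 ≤ c := (abs_nonneg _).trans (hc i)
    refine summable_of_sum_range_le (c := c + c) (fun n => pow_mulVec_nonneg hA hv n i) fun n => ?_
    simp only [pow_mulVec_eq_sub huv]
    rw [Finset.sum_range_sub' (fun n => (A ^ n *ᵥ u) i)]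
    have h0 := pow_mulVec_apply_le hA hA1 hc0 hc 0 i
    have h1 := pow_mulVec_apply_le hA hA1 hc0 hc n i
    linarith [(abs_le.1 h0).2, (abs_le.1 h1).1]
  refine ⟨fun i => ∑' n, (A ^ n *ᵥ v) i, fun i => tsum_nonneg fun n => pow_mulVec_nonneg hA hv n i,
    fun i => (hsum i).hasSum, funext fun i => ?_⟩
  have hshift : HasSum (fun n => (A ^ (n + 1) *ᵥ v) i)
      ((A *ᵥ fun i => ∑' n, (A ^ n *ᵥ v) i) i) := by
    simp only [pow_succ', ← mulVec_mulVec]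
    exact hasSum_sum fun k _ => (hsum k).hasSum.mul_left (A i k)
  have := (hsum i).tsum_eq_zero_add
  rw [hshift.tsum_eq, pow_zero, one_mulVec] at this
  rw [sub_mulVec, one_mulVec, Pi.sub_apply]
  linarith

/-- For a substochastic matrix `A` with `1 - A` invertible and `w = v + A w`, the series
`∑ (n + 1) Aⁿ v` converges, to a solution of `s = w + A s`. -/
lemma exists_hasSum_succ_mul_pow_mulVec {A : Matrix S S ℝ} (hA : ∀ i k, 0 ≤ A i k)
    (hA1 : ∀ i, ∑ k, A i k ≤ 1) (hu : IsUnit (1 - A)) {v w : S → ℝ} (hv : 0 ≤ v) (hw : 0 ≤ w)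
    (hvw : (1 - A) *ᵥ w = v) (hsw : ∀ i, HasSum (fun n => (A ^ n *ᵥ v) i) (w i)) :
    ∃ s : S → ℝ, (∀ i, HasSum (fun n : ℕ => ((n : ℝ) + 1) * (A ^ n *ᵥ v) i) (s i)) ∧
      (1 - A) *ᵥ s = w := by
  obtain ⟨z, -, hz, -⟩ := exists_hasSum_pow_mulVec hA hA1 hu hw
  have hnn : ∀ n i, 0 ≤ (A ^ n *ᵥ v) i := fun n i => pow_mulVec_nonneg hA hv n i
  have hsum : ∀ i, Summable fun n : ℕ => ((n : ℝ) + 1) * (A ^ n *ᵥ v) i := by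
    intro i
    refine summable_of_sum_range_le (c := z i)
      (fun n => mul_nonneg (by positivity) (hnn n i)) fun n => ?_
    -- Abel summation with `v = w - A w`; dropping the nonnegative boundary term bounds the partial
    -- sums by `∑ Aᵏ w = z`.
    have habel : ∑ k ∈ Finset.range n, ((k : ℝ) + 1) * (A ^ k *ᵥ v) i =
        ∑ k ∈ Finset.range n, (A ^ k *ᵥ w) i - n * (A ^ n *ᵥ w) i := by
      induction n with
      | zero => simp
      | succ n ih =>
        rw [Finset.sum_range_succ, ih, Finset.sum_range_succ, pow_mulVec_eq_sub hvw]
        push_cast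
        ring
    rw [habel]
    have h1 : 0 ≤ n * (A ^ n *ᵥ w) i :=
      mul_nonneg n.cast_nonneg (pow_mulVec_nonneg hA hw n i)
    have h2 := sum_le_hasSum (Finset.range n) (fun k _ => pow_mulVec_nonneg hA hw k i) (hz i)
    linarith
  refine ⟨fun i => ∑' n : ℕ, ((n : ℝ) + 1) * (A ^ n *ᵥ v) i, fun i => (hsum i).hasSum,
    funext fun i => ?_⟩
  have hshift : HasSum (fun n : ℕ => ((n : ℝ) + 1) * (A ^ (n + 1) *ᵥ v) i)
      ((A *ᵥ fun i => ∑' n : ℕ, ((n : ℝ) + 1) * (A ^ n *ᵥ v) i) i) := by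
    have := hasSum_sum (s := Finset.univ) fun k _ => (hsum k).hasSum.mul_left (A i k)
    refine this.congr_fun fun n => ?_
    rw [pow_succ', ← mulVec_mulVec]
    simp only [mulVec, dotProduct, Finset.mul_sum]
    exact Finset.sum_congr rfl fun k _ => Finset.sum_congr rfl fun l _ => by ring
  -- With the zeroth terms removed, `(n + 2) - 1 = n + 1` gives `(s - v) - (w - v) = A s`.
  have hdiff := hasSum_nat_add_iff' 1 |>.2 (hsum i).hasSum
  have hw1 := hasSum_nat_add_iff' 1 |>.2 (hsw i)
  have := (hdiff.sub hw1).unique (hshift.congr_fun fun n => by push_cast; ring)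
  simp only [Finset.sum_range_one, pow_zero, one_mulVec, Nat.cast_zero, zero_add, one_mul] at this
  rw [sub_mulVec, one_mulVec, Pi.sub_apply]
  linarith

end Matrix

/-! ### Solving the first-step equations through `G` -/

section Algebra

open Matrix

variable {S : Type*} [Fintype S] [DecidableEq S] {P : Matrix S S ℝ}

lemma inv_kernelMatrix_mulVec_one (hP : P ∈ rowStochastic ℝ S) {b : S}
    (hK : IsUnit (kernelMatrix P b)) : (kernelMatrix P b)⁻¹ *ᵥ 1 = 1 := by
  have h : kernelMatrix P b *ᵥ 1 = 1 := by
    funext i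
    rw [kernelMatrix_mulVec, one_vecMul_of_mem_rowStochastic hP]
    simp
  conv_lhs => rw [← h]
  rw [mulVec_mulVec, nonsing_inv_mul _ ((isUnit_iff_isUnit_det _).1 hK), one_mulVec]

/-- The solution `v` of `v = f + Q v`, where `Q` is `P` with its `j`-th column removed, in terms
of the generalized inverse of `1 - P`. -/
lemma apply_eq_of_one_sub_tabooMatrix_mulVec (hP : P ∈ rowStochastic ℝ S) {b : S}
    (hK : IsUnit (kernelMatrix P b)) {j : S} {v f : S → ℝ}
    (h : (1 - tabooMatrix P j) *ᵥ v = f) (i : S) :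
    v i = ((kernelMatrix P b)⁻¹ *ᵥ f) i - v j * (kernelMatrix P b)⁻¹ i j
      + v j * (Pi.single j 1 : S → ℝ) i + (v b - v j * (Pi.single j 1 : S → ℝ) b) := by
  have key : kernelMatrix P b *ᵥ (v - v j • Pi.single j 1) =
      f - v j • Pi.single j 1 + (v b - v j * (Pi.single j 1 : S → ℝ) b) • 1 := by
    funext k
    have hk := congrFun h k
    rw [sub_mulVec, one_mulVec, Pi.sub_apply, tabooMatrix_mulVec] at hk
    have hcol : (P *ᵥ Pi.single j 1) k = P k j := by simp
    rw [kernelMatrix_mulVec, mulVec_sub, mulVec_smul]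
    simp only [Pi.sub_apply, Pi.add_apply, Pi.smul_apply, smul_eq_mul, hcol, Pi.one_apply]
    linarith
  have hG := congrArg ((kernelMatrix P b)⁻¹ *ᵥ ·) key
  simp only [mulVec_mulVec, nonsing_inv_mul _ ((isUnit_iff_isUnit_det _).1 hK), one_mulVec,
    mulVec_add, mulVec_sub, mulVec_smul, inv_kernelMatrix_mulVec_one hP hK] at hG
  have hi := congrFun hG i
  simp only [Pi.sub_apply, Pi.add_apply, Pi.smul_apply, smul_eq_mul, Pi.one_apply, mul_one,
    mulVec_single_one, Matrix.col_apply] at hi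
  linarith

/-- If `w = 1 + Q w` and `s = w + Q s`, where `Q` is `P` with its `j`-th column removed, then `w`
and `s` are given by the entries of `G` and `G ^ 2`. -/
lemma passage_equations_solution (hP : P ∈ rowStochastic ℝ S) {b : S}
    (hK : IsUnit (kernelMatrix P b)) {G : Matrix S S ℝ} (hG : G = (kernelMatrix P b)⁻¹)
    {j : S} {w s : S → ℝ} (hw : (1 - tabooMatrix P j) *ᵥ w = 1)
    (hs : (1 - tabooMatrix P j) *ᵥ s = w) :
    s j = w j * (1 + w j * (G j j - (G ^ 2) b j)) ∧
      ∀ i, i ≠ j → s i = w j * ((G ^ 2) j j - (G ^ 2) i j + w i * (G j j - (G ^ 2) b j)) := by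
  have ew := apply_eq_of_one_sub_tabooMatrix_mulVec hP hK hw
  have es := apply_eq_of_one_sub_tabooMatrix_mulVec hP hK hs
  rw [← hG] at ew es
  have hG1 : G *ᵥ 1 = 1 := by rw [hG]; exact inv_kernelMatrix_mulVec_one hP hK
  rw [hG1] at ew
  -- Row `j` eliminates the unknown additive constant.
  have ew' : ∀ i, w i = w j * G j j - w j * G i j + w j * (Pi.single j 1 : S → ℝ) i := fun i => by
    have h1 := ew i
    have h2 := ew j
    simp only [Pi.one_apply, Pi.single_eq_same] at h1 h2
    linarith
  -- In row `b` the terms `w b` cancel, leaving an equation for `w j` alone.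
  have hb : w j * G b j = 1 := by
    have h1 := ew b
    have h2 := ew' b
    have h3 := ew j
    simp only [Pi.one_apply, Pi.single_eq_same] at h1 h3
    linarith
  have hGw : ∀ i, (G *ᵥ w) i = w j * G j j - w j * (G ^ 2) i j + w j * G i j := fun i => by
    have : w = (w j * G j j) • 1 - w j • (G *ᵥ Pi.single j 1) + w j • Pi.single j 1 := by
      funext k
      rw [ew' k]
      simp
    conv_lhs => rw [this]
    rw [mulVec_add, mulVec_sub, mulVec_smul, mulVec_smul, mulVec_smul, hG1, mulVec_mulVec, ← pow_two]
    simp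
  have es' : ∀ i, s i = w j * ((G ^ 2) j j - (G ^ 2) i j + G i j - G j j)
      + s j * (G j j - G i j + (Pi.single j 1 : S → ℝ) i) := fun i => by
    have h1 := es i
    have h2 := es j
    rw [hGw] at h1 h2
    simp only [Pi.single_eq_same] at h2
    linarith
  have hsj : s j = w j * (1 + w j * (G j j - (G ^ 2) b j)) := by
    have h1 := es b
    have h2 := es' b
    have h3 := es j
    rw [hGw] at h1 h3
    simp only [Pi.single_eq_same] at h3
    -- Row `b` again: `s b` cancels and `s j * G b j = (G w) b`; multiplying by `w j` and using `hb`
    -- isolates `s j`.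
    have h4 : s j * G b j = w j * (G j j - (G ^ 2) b j + G b j) := by linarith
    linear_combination w j * h4 + (w j - s j) * hb
  refine ⟨hsj, fun i hi => ?_⟩
  have h1 := ew' i
  have h2 := es' i
  rw [Pi.single_eq_of_ne hi] at h1 h2
  rw [h2, hsj, h1]
  ring

end Algebra

/-! ### Moments from tail sums -/

section Tail

variable {Ω : Type*} [MeasurableSpace Ω] {ν : Measure Ω}

lemma hasSum_weighted_indicator_Ioi (a : ℕ → ℝ) (n : ℕ) :
    HasSum (fun k => if k < n then a k else 0) (∑ k ∈ Finset.range n, a k) := by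
  have : ∑ k ∈ Finset.range n, a k = ∑ k ∈ Finset.range n, if k < n then a k else 0 :=
    Finset.sum_congr rfl fun k hk => by rw [if_pos (Finset.mem_range.1 hk)]
  rw [this]
  exact hasSum_sum_of_ne_finset_zero fun k hk => if_neg (by simpa using hk)

/-- Summation by parts for the expectation of a partial sum up to a random index. -/
lemma integral_sum_range_of_hasSum [IsFiniteMeasure ν] {N : Ω → ℕ} (hN : Measurable N)
    {a : ℕ → ℝ} (ha : ∀ n, 0 ≤ a n) {c : ℝ}
    (h : HasSum (fun n => a n * ν.real {ω | n < N ω}) c) :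
    Integrable (fun ω => ∑ k ∈ Finset.range (N ω), a k) ν ∧
      ∫ ω, ∑ k ∈ Finset.range (N ω), a k ∂ν = c := by
  have hmeas : ∀ n, MeasurableSet {ω | n < N ω} := fun n => hN measurableSet_Ioi
  set F : ℕ → Ω → ℝ := fun n => {ω | n < N ω}.indicator fun _ => a n with hF
  have hFnn : ∀ n ω, 0 ≤ F n ω := fun n ω => Set.indicator_nonneg (fun _ _ => ha n) ω
  have hFint : ∀ n, Integrable (F n) ν := fun n => (integrable_const _).indicator (hmeas n)
  have hFval : ∀ n, ∫ ω, F n ω ∂ν = a n * ν.real {ω | n < N ω} := fun n => by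
    rw [hF, integral_indicator_const _ (hmeas n), smul_eq_mul, mul_comm]
  have hFsum : ∀ ω, HasSum (fun n => F n ω) (∑ k ∈ Finset.range (N ω), a k) := fun ω =>
    (hasSum_weighted_indicator_Ioi a (N ω)).congr_fun fun n => by
      simp [hF, Set.indicator_apply]
  have hnorm : ∀ n, ∫ ω, ‖F n ω‖ ∂ν = a n * ν.real {ω | n < N ω} := fun n => by
    rw [← hFval]
    exact integral_congr_ae (ae_of_all _ fun ω => Real.norm_of_nonneg (hFnn n ω))
  have hmain := hasSum_integral_of_summable_integral_norm hFint
    (by simpa only [hnorm] using h.summable)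
  simp only [hFval, fun ω => (hFsum ω).tsum_eq] at hmain
  refine ⟨?_, hmain.unique h⟩
  have hmeasSum : Measurable fun ω => ∑ k ∈ Finset.range (N ω), a k :=
    (measurable_from_top (f := fun n => ∑ k ∈ Finset.range n, a k)).comp hN
  -- The interchange theorem gives only the value of the integral; finiteness is obtained separately
  -- by Tonelli.
  refine ⟨hmeasSum.aestronglyMeasurable, ?_⟩
  rw [hasFiniteIntegral_iff_ofReal (ae_of_all _ fun ω => Finset.sum_nonneg fun k _ => ha k)]
  calc ∫⁻ ω, ENNReal.ofReal (∑ k ∈ Finset.range (N ω), a k) ∂ν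
      = ∫⁻ ω, ∑' n, ENNReal.ofReal (F n ω) ∂ν := by
        refine lintegral_congr fun ω => ?_
        rw [← (hFsum ω).tsum_eq, ENNReal.ofReal_tsum_of_nonneg (fun n => hFnn n ω)
          (hFsum ω).summable]
    _ = ∑' n, ENNReal.ofReal (a n * ν.real {ω | n < N ω}) := by
        rw [lintegral_tsum fun n => (hFint n).aemeasurable.ennreal_ofReal]
        refine tsum_congr fun n => ?_
        rw [← ofReal_integral_eq_lintegral_ofReal (hFint n) (ae_of_all _ (hFnn n)), hFval]
    _ < ⊤ := by
        rw [← ENNReal.ofReal_tsum_of_nonneg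
          (fun n => mul_nonneg (ha n) measureReal_nonneg) h.summable]
        exact ENNReal.ofReal_lt_top

/-- The first two moments of a random natural number from the tails of its distribution. -/
lemma moments_of_hasSum_tail [IsFiniteMeasure ν] {N : Ω → ℕ} (hN : Measurable N) {c d : ℝ}
    (hc : HasSum (fun n => ν.real {ω | n < N ω}) c)
    (hd : HasSum (fun n : ℕ => ((n : ℝ) + 1) * ν.real {ω | n < N ω}) d) :
    MemLp (fun ω => (N ω : ℝ)) 2 ν ∧ ∫ ω, (N ω : ℝ) ∂ν = c ∧
      ∫ ω, (N ω : ℝ) ^ 2 ∂ν = 2 * d - c := by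
  obtain ⟨i1, e1⟩ := integral_sum_range_of_hasSum hN (a := fun _ => 1) (fun _ => zero_le_one)
    (by simpa using hc)
  obtain ⟨i2, e2⟩ := integral_sum_range_of_hasSum hN (a := fun n => (n : ℝ) + 1)
    (fun n => by positivity) hd
  simp only [Finset.sum_const, Finset.card_range, nsmul_eq_mul, mul_one] at i1 e1
  have hsq : ∀ n : ℕ, (n : ℝ) ^ 2 = 2 * (∑ k ∈ Finset.range n, ((k : ℝ) + 1)) - n := fun n => by
    induction n with
    | zero => simp
    | succ n ih =>
      rw [Finset.sum_range_succ]
      push_cast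
      linarith
  refine ⟨(memLp_two_iff_integrable_sq i1.aestronglyMeasurable).2 ?_, e1, ?_⟩
  · simp only [hsq]
    exact (i2.const_mul 2).sub i1
  · simp only [hsq]
    rw [integral_sub (i2.const_mul 2) i1, integral_const_mul, e1, e2]

end Tail

/-! ### Law of the first passage time -/

section Passage

open Matrix

variable {S : Type*} {Ω : Type*}

lemma lt_firstPassageTime_iff (X : ℕ → Ω → S) (j : S) (ω : Ω) (n : ℕ) :
    (n : ℕ∞) < firstPassageTime X j ω ↔ ∀ k, 1 ≤ k → k ≤ n → X k ω ≠ j := by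
  rw [← not_le, firstPassageTime, ← not_iff_not, not_not]
  push Not
  constructor
  · intro h
    by_contra! hne
    have : ((n + 1 : ℕ) : ℕ∞) ≤ ⨅ (n : ℕ) (_ : 1 ≤ n ∧ X n ω = j), (n : ℕ∞) := by
      refine le_iInf₂ fun k hk => ?_
      by_contra hlt
      have hlt : k < n + 1 := by exact_mod_cast not_le.1 hlt
      exact hne k hk.1 (Nat.lt_succ_iff.1 hlt) hk.2
    have := this.trans h
    norm_cast at this
    omega
  · rintro ⟨k, h1, hk, hX⟩
    exact (iInf₂_le k ⟨h1, hX⟩).trans (by exact_mod_cast hk)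

variable [MeasurableSpace Ω] {ν : Measure Ω} {X : ℕ → Ω → S}

/-- The infinite event lies in every tail event, and summable tail probabilities tend to zero. -/
lemma ae_firstPassageTime_ne_top [IsFiniteMeasure ν] {j : S}
    {c : ℝ} (hc : HasSum (fun n : ℕ => ν.real {ω | (n : ℕ∞) < firstPassageTime X j ω}) c) :
    ∀ᵐ ω ∂ν, firstPassageTime X j ω ≠ ⊤ := by
  rw [ae_iff]
  simp only [not_not]
  rw [← measureReal_eq_zero_iff]
  refine le_antisymm (ge_of_tendsto' hc.summable.tendsto_atTop_zero fun n => ?_) measureReal_nonneg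
  exact measureReal_mono fun ω (hω : firstPassageTime X j ω = ⊤) => by
    simp [hω]

variable [MeasurableSpace S] [MeasurableSingletonClass S] {P : Matrix S S ℝ}

lemma IsMarkovChain.measurableSet_avoid (hX : IsMarkovChain ν X P) (j : S) (n d : ℕ) :
    MeasurableSet {ω | ∀ k, n < k → k ≤ n + d → X k ω ≠ j} := by
  simp only [Set.ofPred_forall]
  exact MeasurableSet.iInter fun k => MeasurableSet.iInter fun _ => MeasurableSet.iInter fun _ =>
    (hX.measurable k (measurableSet_singleton j)).compl

lemma IsMarkovChain.measurable_toNat_firstPassageTime (hX : IsMarkovChain ν X P) (j : S) :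
    Measurable fun ω => (firstPassageTime X j ω).toNat := by
  have hlt : ∀ n : ℕ, MeasurableSet {ω | (n : ℕ∞) < firstPassageTime X j ω} := fun n => by
    convert hX.measurableSet_avoid j 0 n using 1
    ext ω
    simp only [Set.mem_ofPred_eq, lt_firstPassageTime_iff, zero_add]
    rfl
  refine measurable_of_Ioi fun n => ?_
  -- As `toNat` sends `⊤` to 0, the infinite event, the intersection of all tails, must be removed.
  have : (fun ω => (firstPassageTime X j ω).toNat) ⁻¹' Set.Ioi n =
      {ω | (n : ℕ∞) < firstPassageTime X j ω} \
        ⋂ k : ℕ, {ω | (k : ℕ∞) < firstPassageTime X j ω} := by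
    ext ω
    change n < (firstPassageTime X j ω).toNat ↔ (n : ℕ∞) < firstPassageTime X j ω ∧ _
    rw [Set.mem_iInter]
    change _ ↔ _ ∧ ¬∀ k : ℕ, (k : ℕ∞) < firstPassageTime X j ω
    generalize firstPassageTime X j ω = t
    induction t with
    | top => simp
    | coe t =>
      simp only [ENat.toNat_natCast, Nat.cast_lt, iff_self_and]
      exact fun _ h => lt_irrefl t (h t)
  rw [this]
  exact (hlt n).diff (MeasurableSet.iInter hlt)

variable [Fintype S] [DecidableEq S]

/-- Given the path up to time `n`, the state `j` is avoided during the next `d` steps with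
probability `(Q ^ d e)` at the present state, where `Q` is `P` with its `j`-th column removed. -/
lemma IsMarkovChain.measureReal_path_inter_avoid [IsFiniteMeasure ν] (hX : IsMarkovChain ν X P)
    (hP : P ∈ rowStochastic ℝ S) (j : S) (d n : ℕ) (x : ℕ → S) :
    ν.real ({ω | ∀ k ≤ n, X k ω = x k} ∩ {ω | ∀ k, n < k → k ≤ n + d → X k ω ≠ j}) =
      ν.real {ω | ∀ k ≤ n, X k ω = x k} * (tabooMatrix P j ^ d *ᵥ 1) (x n) := by
  induction d generalizing n x with
  | zero =>
    have : {ω | ∀ k, n < k → k ≤ n + 0 → X k ω ≠ j} = Set.univ :=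
      Set.eq_univ_of_forall fun ω k h1 h2 => by omega
    rw [this, Set.inter_univ, pow_zero, one_mulVec, Pi.one_apply, mul_one]
  | succ d ih =>
    set E := {ω | ∀ k ≤ n, X k ω = x k} ∩ {ω | ∀ k, n < k → k ≤ n + (d + 1) → X k ω ≠ j} with hE
    -- Condition on the next state `l`: `l = j` contributes nothing, and otherwise the path is
    -- extended by `l` and the induction hypothesis is used at time `n + 1`.
    have hsplit := sum_measureReal_preimage_singleton (μ := ν.restrict E) Finset.univ
      (f := X (n + 1)) fun l _ => hX.measurable _ (measurableSet_singleton l)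
    rw [Finset.coe_univ, Set.preimage_univ, measureReal_restrict_apply_univ] at hsplit
    rw [← hsplit, pow_succ', ← mulVec_mulVec]
    rw [mulVec, dotProduct, Finset.mul_sum]
    refine Finset.sum_congr rfl fun l _ => ?_
    rw [measureReal_restrict_apply (hX.measurable _ (measurableSet_singleton l)), tabooMatrix_apply]
    split_ifs with hl
    · have : X (n + 1) ⁻¹' {l} ∩ E = ∅ := by
        refine Set.eq_empty_of_forall_notMem fun ω ⟨h1, _, h3⟩ => ?_
        exact h3 (n + 1) (by omega) (by omega) (by rw [← hl]; exact h1)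
      rw [this]
      simp
    · set y := Function.update x (n + 1) l with hy
      have hyn : y n = x n := Function.update_of_ne (by omega) _ _
      have hyn1 : y (n + 1) = l := Function.update_self _ _ _
      have hyk : ∀ k ≤ n, y k = x k := fun k hk => Function.update_of_ne (by omega) _ _
      have hpath : {ω | ∀ k ≤ n, X k ω = y k} = {ω | ∀ k ≤ n, X k ω = x k} :=
        Set.ext fun ω => forall₂_congr fun k hk => by rw [hyk k hk]
      have hset : X (n + 1) ⁻¹' {l} ∩ E = {ω | ∀ k ≤ n + 1, X k ω = y k} ∩
          {ω | ∀ k, n + 1 < k → k ≤ n + 1 + d → X k ω ≠ j} := by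
        ext ω
        constructor
        · rintro ⟨h1, h2, h3⟩
          refine ⟨fun k hk => ?_, fun k hk1 hk2 => h3 k (by omega) (by omega)⟩
          rcases Nat.le_succ_iff.1 hk with hk | rfl
          · rw [hyk k hk]; exact h2 k hk
          · exact Eq.trans h1 hyn1.symm
        · rintro ⟨h1, h2⟩
          have h4 : X (n + 1) ω = l := (h1 (n + 1) le_rfl).trans hyn1
          refine ⟨h4, fun k hk => (h1 k (by omega)).trans (hyk k hk), fun k hk1 hk2 => ?_⟩
          rcases (Nat.succ_le_of_lt hk1).eq_or_lt with rfl | hk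
          · exact fun h => hl (h4.symm.trans h)
          · exact h2 k hk (by omega)
      have hstep : ν.real {ω | ∀ k ≤ n + 1, X k ω = y k} =
          ν.real {ω | ∀ k ≤ n, X k ω = x k} * P (x n) l := by
        rw [measureReal_def, hX.markov n y, ENNReal.toReal_mul, hpath, hyn, hyn1,
          ENNReal.toReal_ofReal (nonneg_of_mem_rowStochastic hP), measureReal_def]
      rw [hset, ih, hstep, hyn1, mul_assoc]

lemma IsMarkovChain.measureReal_lt_firstPassageTime [IsProbabilityMeasure ν]
    (hX : IsMarkovChain ν X P) (hP : P ∈ rowStochastic ℝ S) {i : S} (hi : ∀ᵐ ω ∂ν, X 0 ω = i)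
    (j : S) (n : ℕ) :
    ν.real {ω | (n : ℕ∞) < firstPassageTime X j ω} = (tabooMatrix P j ^ n *ᵥ 1) i := by
  have h := hX.measureReal_path_inter_avoid hP j n 0 fun _ => i
  have h0 : ∀ᵐ ω ∂ν, ω ∈ {ω | ∀ k ≤ 0, X k ω = i} := by
    filter_upwards [hi] with ω hω k hk
    rw [Nat.le_zero.1 hk, hω]
  have h1 : ν.real {ω | ∀ k ≤ 0, X k ω = i} = 1 :=
    (measureReal_congr (Filter.eventuallyEq_univ.2 h0)).trans probReal_univ
  rw [h1, one_mul] at h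
  rw [← h]
  refine measureReal_congr ?_
  filter_upwards [h0] with ω hω
  refine propext ?_
  change (n : ℕ∞) < firstPassageTime X j ω ↔ _ ∧ _
  rw [lt_firstPassageTime_iff]
  exact ⟨fun h => ⟨hω, fun k h1 h2 => h k h1 (by omega)⟩, fun h k h1 h2 => h.2 k h1 (by omega)⟩

/-- The first two moments of the first passage time solve the first-step equations. -/
lemma IsMarkovChain.exists_passage_moments (hP : P ∈ rowStochastic ℝ S) (hirr : P.IsIrreducible)
    (μ : S → Measure Ω) [∀ i, IsProbabilityMeasure (μ i)] (hX : ∀ i, IsMarkovChain (μ i) X P)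
    (hstart : ∀ i, ∀ᵐ ω ∂(μ i), X 0 ω = i) (j : S) :
    ∃ w s : S → ℝ, (1 - tabooMatrix P j) *ᵥ w = 1 ∧ (1 - tabooMatrix P j) *ᵥ s = w ∧
      ∀ i, (∀ᵐ ω ∂(μ i), firstPassageTime X j ω ≠ ⊤) ∧ MemLp (passageTimeReal X j) 2 (μ i) ∧
        ∫ ω, passageTimeReal X j ω ∂(μ i) = w i ∧
        ∫ ω, passageTimeReal X j ω ^ 2 ∂(μ i) = 2 * s i - w i := by
  have hQ := tabooMatrix_nonneg hP j
  have hQ1 : ∀ i, ∑ k, tabooMatrix P j i k ≤ 1 := fun i => by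
    rw [← sum_row_of_mem_rowStochastic hP i]
    refine Finset.sum_le_sum fun k _ => ?_
    rw [tabooMatrix_apply]
    split_ifs
    exacts [nonneg_of_mem_rowStochastic hP, le_rfl]
  have hu := isUnit_one_sub_tabooMatrix hP hirr j
  obtain ⟨w, hw0, hw, hweq⟩ := exists_hasSum_pow_mulVec hQ hQ1 hu (v := 1) zero_le_one
  obtain ⟨s, hs, hseq⟩ :=
    exists_hasSum_succ_mul_pow_mulVec hQ hQ1 hu zero_le_one hw0 hweq hw
  refine ⟨w, s, hweq, hseq, fun i => ?_⟩
  have htail := (hX i).measureReal_lt_firstPassageTime hP (hstart i) j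
  have hfin : ∀ᵐ ω ∂(μ i), firstPassageTime X j ω ≠ ⊤ :=
    ae_firstPassageTime_ne_top (c := w i) (by simpa only [htail] using hw i)
  -- Almost sure finiteness makes the value of `toNat` at `⊤` harmless.
  have htail' : ∀ n : ℕ, (μ i).real {ω | n < (firstPassageTime X j ω).toNat} =
      (tabooMatrix P j ^ n *ᵥ 1) i := fun n => by
    rw [← htail]
    refine measureReal_congr ?_
    filter_upwards [hfin] with ω hω
    refine propext ?_
    change n < (firstPassageTime X j ω).toNat ↔ (n : ℕ∞) < firstPassageTime X j ω
    rw [← Nat.cast_lt (α := ℕ∞), ENat.natCast_toNat hω]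
  have hmeas : Measurable fun ω => (firstPassageTime X j ω).toNat :=
    (hX i).measurable_toNat_firstPassageTime j
  exact ⟨hfin, moments_of_hasSum_tail hmeas (by simpa only [htail'] using hw i)
    (by simpa only [htail'] using hs i)⟩

end Passage

/-! ### Moments and variances -/

theorem theorem7p9 {S : Type*} [Fintype S] [DecidableEq S]
    [MeasurableSpace S] [MeasurableSingletonClass S]
    (P : Matrix S S ℝ) (hP : P ∈ Matrix.rowStochastic ℝ S) (hirr : P.IsIrreducible)
    {Ω : Type*} [MeasurableSpace Ω] (μ : S → Measure Ω) [∀ i, IsProbabilityMeasure (μ i)]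
    (X : ℕ → Ω → S) (hX : ∀ i, IsMarkovChain (μ i) X P)
    (hstart : ∀ i, ∀ᵐ ω ∂(μ i), X 0 ω = i)
    (b : S) (G : Matrix S S ℝ) (hG : G = (kernelMatrix P b)⁻¹)
    (m m₂ : S → S → ℝ) (hm : m = passageMoment μ X 1) (hm₂ : m₂ = passageMoment μ X 2) :
    -- the matrix inverse exists
    IsUnit (kernelMatrix P b) ∧
    -- the first passage times are almost surely finite, with finite second moments
    (∀ i j, ∀ᵐ ω ∂(μ i), firstPassageTime X j ω ≠ ⊤) ∧
    (∀ i j, MemLp (passageTimeReal X j) 2 (μ i)) ∧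
    -- second moments
    (∀ j, m₂ j j = m j j * (1 + 2 * m j j * (G j j - (G ^ 2) b j))) ∧
    (∀ i j, i ≠ j →
      m₂ i j = 2 * m j j * ((G ^ 2) j j - (G ^ 2) i j + m i j * (G j j - (G ^ 2) b j))
        - m i j) ∧
    -- variances
    (∀ j, Var[passageTimeReal X j; μ j] =
      m j j * (1 - m j j + 2 * m j j * (G j j - (G ^ 2) b j))) ∧
    (∀ i j, i ≠ j →
      Var[passageTimeReal X j; μ i] =
        2 * m j j * ((G ^ 2) j j - (G ^ 2) i j + m i j * (G j j - (G ^ 2) b j))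
          - m i j * (1 + m i j)) := by
  have hK := isUnit_kernelMatrix hP hirr b
  -- The target comes first here: `w j i` belongs to the passage from `i` to `j`.
  choose w s hw hs hmom using IsMarkovChain.exists_passage_moments hP hirr μ hX hstart
  have hsol := fun j => passage_equations_solution hP hK hG (hw j) (hs j)
  have em : ∀ i j, m i j = w j i := fun i j => by
    simp only [hm, passageMoment, pow_one]
    exact (hmom j i).2.2.1
  have em₂ : ∀ i j, m₂ i j = 2 * s j i - w j i := fun i j => by
    rw [hm₂]
    exact (hmom j i).2.2.2
  have evar : ∀ i j, Var[passageTimeReal X j; μ i] = m₂ i j - m i j ^ 2 := fun i j => by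
    rw [variance_eq_sub (hmom j i).2.1, em, em₂, ← (hmom j i).2.2.1, (hmom j i).2.2.1,
      ← (hmom j i).2.2.2]
    rfl
  have h1 : ∀ j, m₂ j j = m j j * (1 + 2 * m j j * (G j j - (G ^ 2) b j)) := fun j => by
    rw [em₂, em, (hsol j).1]
    ring
  have h2 : ∀ i j, i ≠ j →
      m₂ i j = 2 * m j j * ((G ^ 2) j j - (G ^ 2) i j + m i j * (G j j - (G ^ 2) b j))
        - m i j := fun i j hij => by
    rw [em₂, em, em, (hsol j).2 i hij]
    ring
  refine ⟨hK, fun i j => (hmom j i).1, fun i j => (hmom j i).2.1, h1, h2, fun j => ?_,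
    fun i j hij => ?_⟩
  · rw [evar, h1]
    ring
  · rw [evar, h2 i j hij]
    ring
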